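/- Let $n\ge 1$, let $r>s\ge 1$ with $r\ge 3$, let $U\subseteq\mathbb R^n$ be open and connected, and let $\Phi:\bar x:U\to\mathbb R^{n+1}$ be an injective $C^r$-immersion. Let $\bar\xi$ be a $C^1$ field of unit normals of $\Phi$ (the Euclidean normalization), $g_{ij}=\langle \bar x_{/i},\bar x_{/j}\rangle$, $h_{ij}=\langle\bar\xi,\bar x_{/ij}\rangle$, and suppose that the Gaussian curvature $K=\det(h_{ij})/\det(g_{ij})$ vanishes nowhere on $U$. Let $\bar y:U\to\mathbb R^{n+1}$ be a relative $C^s$-normalization, i.e. a $C^s$-map such that at every point $\bar y$ is not tangent to $\Phi$ while all $\bar y_{/i}$ are tangent to $\Phi$. Let $q=\langle\bar\xi,\bar y\rangle$ be its support function, $\bar X$ its covector ($\langle\bar X,\bar x_{/i}\rangle=0$ for all $i$, $\langle\bar X,\bar y\rangle=1$), $G_{ij}=\langle\bar X,\bar x_{/ij}\rangle$ its relative metric with Levi-Civita connection $\nabla^G$, $A_{ijk}=\langle\bar X,\nabla^G_k\nabla^G_j\bar x_{/i}\rangle$ its Darboux tensor, and $\bar T=\frac1n A_{ijk}G^{jk}G^{im}\bar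 x_{/m}$ its Tchebychev vector field. (If the Christoffel symbols $\Gamma^m_{ij}$ of $G$ are only continuous, $A_{ijk}$ is formed with the product rule, omitting the tangential terms $(\partial_k\Gamma^m_{ij})\bar x_{/m}$, to which $\bar X$ is orthogonal.) Then the following properties are equivalent: (a) the function $\varphi=|K|^{-\frac1{2n}}\,|q|^{\frac{n+2}{2n}}$ is constant on $U$; (b) $\langle\bar T,d\bar\xi\rangle=0$ at every point; (c) there is a constant $\lambda\in\mathbb R\setminus\{0\}$ with $q=\lambda\,|K|^{\frac1{n+2}}$ on $U$. Moreover, for each $\lambda\ne 0$, $q=\lambda|K|^{\frac1{n+2}}$ holds on $U$ if and only if $\bar y=\lambda\,\bar y_{\mathrm{AFF}}$ on $U$, where $\bar y_{\mathrm{AFF}}=-h^{ij}(q_{\mathrm{AFF}})_{/i}\,\bar x_{/j}+q_{\mathrm{AFF}}\,\bar\xi$ with $q_{\mathrm{AFF}}=|K|^{\frac1{n+2}}$ is the equiaffine normalization. -/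

import Mathlib

open scoped RealInnerProductSpace

noncomputable section

namespace RelGeom

/-- The parameter space `ℝⁿ`. -/
abbrev Param (n : ℕ) := EuclideanSpace ℝ (Fin n)

/-- The ambient Euclidean space `ℝⁿ⁺¹`. -/
abbrev Amb (n : ℕ) := EuclideanSpace ℝ (Fin (n + 1))

/-- The partial derivative `f_{/i} = ∂f/∂uⁱ` at `u`. -/
def pd {n : ℕ} {V : Type*} [NormedAddCommGroup V] [NormedSpace ℝ V]
    (i : Fin n) (f : Param n → V) (u : Param n) : V :=
  fderiv ℝ f u (EuclideanSpace.single i (1 : ℝ))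

/-- The tangent vector space of the hypersurface `x` at the point with parameter `u`. -/
def tangent {n : ℕ} (x : Param n → Amb n) (u : Param n) : Submodule ℝ (Amb n) :=
  Submodule.span ℝ (Set.range fun i => pd i x u)

/-- `x` is an injective `C^r`-immersion of the open set `U ⊆ ℝⁿ` into `ℝⁿ⁺¹`. -/
structure IsHypersurface {n : ℕ} (r : WithTop ℕ∞) (U : Set (Param n)) (x : Param n → Amb n) :
    Prop where
  isOpen : IsOpen U
  contDiffOn : ContDiffOn ℝ r x U
  injOn : Set.InjOn x U
  immersion : ∀ u ∈ U, LinearIndependent ℝ fun i => pd i x u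

/-- `y` is a relative `C^s`-normalization of the hypersurface `x` on `U`. -/
structure IsRelNormalization {n : ℕ} (s : WithTop ℕ∞) (U : Set (Param n))
    (x y : Param n → Amb n) : Prop where
  contDiffOn : ContDiffOn ℝ s y U
  not_mem_tangent : ∀ u ∈ U, y u ∉ tangent x u
  pd_mem_tangent : ∀ u ∈ U, ∀ i, pd i y u ∈ tangent x u

/-- `ξ` is a Euclidean normalization of `x` on `U`: a `C¹` field of unit normals. -/
structure IsEuclNormalization {n : ℕ} (U : Set (Param n)) (x ξ : Param n → Amb n) : Prop where
  contDiffOn : ContDiffOn ℝ 1 ξ U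
  norm_eq_one : ∀ u ∈ U, ‖ξ u‖ = 1
  normal : ∀ u ∈ U, ∀ i, ⟪ξ u, pd i x u⟫ = 0

/-- The first fundamental form `g_{ij} = ⟨x_{/i}, x_{/j}⟩`. -/
def firstForm {n : ℕ} (x : Param n → Amb n) (u : Param n) : Matrix (Fin n) (Fin n) ℝ :=
  Matrix.of fun i j => ⟪pd i x u, pd j x u⟫

/-- The second fundamental form `h_{ij} = ⟨ξ, x_{/ij}⟩`. -/
def secondForm {n : ℕ} (x ξ : Param n → Amb n) (u : Param n) : Matrix (Fin n) (Fin n) ℝ :=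
  Matrix.of fun i j => ⟪ξ u, pd j (pd i x) u⟫

/-- The Gaussian (Gauss–Kronecker) curvature `K = det (h_{ij}) / det (g_{ij})`. -/
def gaussCurv {n : ℕ} (x ξ : Param n → Amb n) (u : Param n) : ℝ :=
  (secondForm x ξ u).det / (firstForm x u).det

/-- The support function `q = ⟨ξ, y⟩`. -/
def support {n : ℕ} (ξ y : Param n → Amb n) (u : Param n) : ℝ := ⟪ξ u, y u⟫

/-- The defining property of the covector at `u`: `⟨X, x_{/i}⟩ = 0` for all `i`, `⟨X, y⟩ = 1`. -/
def IsCovectorAt {n : ℕ} (x y : Param n → Amb n) (u : Param n) (X : Amb n) : Prop :=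
  (∀ i, ⟪X, pd i x u⟫ = 0) ∧ ⟪X, y u⟫ = 1

/-- The covector `X` of the tangent hyperplane (see `covector_spec` and `covector_unique`). -/
def covector {n : ℕ} (x y : Param n → Amb n) (u : Param n) : Amb n :=
  Classical.epsilon (IsCovectorAt x y u)

theorem covector_spec {n : ℕ} {x y : Param n → Amb n} {u : Param n}
    (hy : y u ∉ tangent x u) : IsCovectorAt x y u (covector x y u) := by
  apply Classical.epsilon_spec (p := IsCovectorAt x y u)
  have h1 : ∃ N ∈ (tangent x u)ᗮ, ⟪N, y u⟫ ≠ 0 := by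
    by_contra hcon
    push Not at hcon
    apply hy
    rw [← Submodule.orthogonal_orthogonal (tangent x u)]
    exact (Submodule.mem_orthogonal _ _).2 hcon
  obtain ⟨N, hN, hNy⟩ := h1
  refine ⟨(⟪N, y u⟫)⁻¹ • N, fun i => ?_, ?_⟩
  · rw [real_inner_smul_left,
      (Submodule.mem_orthogonal' _ _).1 hN _ (Submodule.subset_span ⟨i, rfl⟩), mul_zero]
  · rw [real_inner_smul_left, inv_mul_cancel₀ hNy]

theorem covector_unique {n : ℕ} {x y : Param n → Amb n} {u : Param n} {X : Amb n}
    (hx : LinearIndependent ℝ fun i => pd i x u) (hy : y u ∉ tangent x u)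
    (hX : IsCovectorAt x y u X) : X = covector x y u := by
  have hc := covector_spec hy
  have hli : LinearIndependent ℝ (Fin.cons (y u) fun i => pd i x u : Fin (n + 1) → Amb n) :=
    linearIndependent_finCons.2 ⟨hx, hy⟩
  have hspan := hli.span_eq_top_of_card_eq_finrank (by simp)
  have hall : ∀ v : Amb n, ⟪X - covector x y u, v⟫ = 0 := by
    intro v
    have hv : v ∈ Submodule.span ℝ
        (Set.range (Fin.cons (y u) fun i => pd i x u : Fin (n + 1) → Amb n)) := by
      rw [hspan]; trivial
    induction hv using Submodule.span_induction with
    | mem w hw =>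
      obtain ⟨j, rfl⟩ := hw
      refine Fin.cases ?_ (fun i => ?_) j
      · simp [inner_sub_left, hX.2, hc.2]
      · simp [inner_sub_left, hX.1 i, hc.1 i]
    | zero => simp
    | add a b _ _ ha hb => rw [inner_add_right, ha, hb, add_zero]
    | smul c a _ ha => rw [real_inner_smul_right, ha, mul_zero]
  exact sub_eq_zero.1 (inner_self_eq_zero.1 (hall _))

/-- The relative metric `G_{ij} = ⟨X, x_{/ij}⟩`. -/
def relMetric {n : ℕ} (x y : Param n → Amb n) (u : Param n) : Matrix (Fin n) (Fin n) ℝ :=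
  Matrix.of fun i j => ⟪covector x y u, pd j (pd i x) u⟫

/-- The Christoffel symbols `Γᵏ_{ij}` of the Levi-Civita connection of a (pseudo-Riemannian)
metric `G` given by its matrix of components. -/
def christoffel {n : ℕ} (G : Param n → Matrix (Fin n) (Fin n) ℝ) (k i j : Fin n)
    (u : Param n) : ℝ :=
  (1 / 2) * ∑ m, (G u)⁻¹ k m *
    (pd i (fun w => G w m j) u + pd j (fun w => G w m i) u - pd m (fun w => G w i j) u)

/-- The second covariant derivative `∇_j x_{/i} = x_{/ij} - Γᵐ_{ij} x_{/m}`. -/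
def covHess {n : ℕ} (G : Param n → Matrix (Fin n) (Fin n) ℝ) (x : Param n → Amb n)
    (i j : Fin n) (u : Param n) : Amb n :=
  pd j (pd i x) u - ∑ m, christoffel G m i j u • pd m x u

/-- The partial derivative `∂_k (∇_j x_{/i})`, written out with the product rule (see
`pd_covHess`). In this form its component transversal to the hypersurface is meaningful as soon
as `x` is `C³` and `G` is `C¹`: the derivatives of the `Γᵐ_{ij}` only enter the tangential part. -/
def dCovHess {n : ℕ} (G : Param n → Matrix (Fin n) (Fin n) ℝ) (x : Param n → Amb n)
    (i j k : Fin n) (u : Param n) : Amb n :=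
  pd k (pd j (pd i x)) u -
    ∑ m, (christoffel G m i j u • pd k (pd m x) u + pd k (christoffel G m i j) u • pd m x u)

theorem pd_covHess {n : ℕ} {G : Param n → Matrix (Fin n) (Fin n) ℝ} {x : Param n → Amb n}
    {i j k : Fin n} {u : Param n} (h2 : DifferentiableAt ℝ (pd j (pd i x)) u)
    (h1 : ∀ m, DifferentiableAt ℝ (pd m x) u)
    (hG : ∀ m, DifferentiableAt ℝ (christoffel G m i j) u) :
    pd k (covHess G x i j) u = dCovHess G x i j k u := by
  have hs : HasFDerivAt (fun w => ∑ m, christoffel G m i j w • pd m x w)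
      (∑ m, (christoffel G m i j u • fderiv ℝ (pd m x) u +
        (fderiv ℝ (christoffel G m i j) u).smulRight (pd m x u))) u :=
    HasFDerivAt.fun_sum fun m _ => (hG m).hasFDerivAt.smul (h1 m).hasFDerivAt
  have ht := (h2.hasFDerivAt.sub hs).fderiv
  have he : covHess G x i j =
      pd j (pd i x) - fun w => ∑ m, christoffel G m i j w • pd m x w := rfl
  unfold dCovHess
  conv_lhs => rw [pd, he, ht]
  simp [pd]

/-- The third covariant derivative
`∇_k ∇_j x_{/i} = ∂_k (∇_j x_{/i}) - Γᵐ_{ki} ∇_j x_{/m} - Γᵐ_{kj} ∇_m x_{/i}`. -/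
def covThird {n : ℕ} (G : Param n → Matrix (Fin n) (Fin n) ℝ) (x : Param n → Amb n)
    (i j k : Fin n) (u : Param n) : Amb n :=
  dCovHess G x i j k u -
    ∑ m, (christoffel G m k i u • covHess G x m j u + christoffel G m k j u • covHess G x i m u)

/-- The Darboux tensor `A_{ijk} = ⟨X, ∇ᴳ_k ∇ᴳ_j x_{/i}⟩`. -/
def darboux {n : ℕ} (x y : Param n → Amb n) (i j k : Fin n) (u : Param n) : ℝ :=
  ⟪covector x y u, covThird (relMetric x y) x i j k u⟫

/-- The Tchebychev vector field `T = (1/n) A_{ijk} Gʲᵏ Gⁱᵐ x_{/m}`. -/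
def tchebychev {n : ℕ} (x y : Param n → Amb n) (u : Param n) : Amb n :=
  (1 / (n : ℝ)) • ∑ i, ∑ j, ∑ k, ∑ m,
    (darboux x y i j k u * (relMetric x y u)⁻¹ j k * (relMetric x y u)⁻¹ i m) • pd m x u

/-- The function `φ = |K|^{-1/(2n)} |q|^{(n+2)/(2n)}`. -/
def phi {n : ℕ} (x ξ y : Param n → Amb n) (u : Param n) : ℝ :=
  |gaussCurv x ξ u| ^ (-1 / (2 * (n : ℝ))) * |support ξ y u| ^ (((n : ℝ) + 2) / (2 * (n : ℝ)))

/-- The support function `|K|^{1/(n+2)}` of the equiaffine normalization. -/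
def supportAff {n : ℕ} (x ξ : Param n → Amb n) (u : Param n) : ℝ :=
  |gaussCurv x ξ u| ^ (1 / ((n : ℝ) + 2))

/-- The normalization with a given support function `q`: `-hⁱʲ q_{/i} x_{/j} + q ξ`. -/
def normalizationOfSupport {n : ℕ} (x ξ : Param n → Amb n) (q : Param n → ℝ) (u : Param n) :
    Amb n :=
  -(∑ i, ∑ j, ((secondForm x ξ u)⁻¹ i j * pd i q u) • pd j x u) + q u • ξ u

/-- The equiaffine normalization. -/
def equiaffine {n : ℕ} (x ξ : Param n → Amb n) : Param n → Amb n :=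
  normalizationOfSupport x ξ (supportAff x ξ)

end RelGeom

end

/-! All three properties say that the scalar function L = (n+2) log|q| - log|K| (`logRatio`) is
constant. For (a) this holds because φ = exp(L/(2n)); for (c) because L/(n+2) is the logarithm of
|q| / |K|^{1/(n+2)}, and q, continuous without zeros on a connected set, keeps one sign.

The link with (b) is a computation. The covector is ξ/q, so G = h/q and every relative quantity
reduces to a Euclidean one. Each A_{ijk} is a combination of first derivatives of G and of products
⟨X_{/j}, x_{/ik}⟩ (`darboux_eq`). In the trace with G^{jk}, Jacobi's formula turns the former into
the derivative of log|det G| = log|det h| - n log|q|, while the Weingarten equations turn the latter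
into derivatives of log det g and log|q|. The sum is A_{ijk} G^{jk} = ½ L_{/i} (`sum_darboux_mul`).
Pairing T with ξ_{/l} brings in -h_{ml}, which cancels G^{im} = q h^{im} up to the factor -q, so ⟨T,
ξ_{/l}⟩ = -(q/(2n)) L_{/l} (`inner_tchebychev_pd`), and (b) means dL = 0.

The last claim holds because y is determined linearly by its support function
(`eq_normalizationOfSupport`). -/

namespace RelGeom

open Filter Topology

/-! ### Partial derivatives and Jacobi's formula -/

section Calculus

variable {n : ℕ} {V : Type*} [NormedAddCommGroup V] [NormedSpace ℝ V]
  {W : Type*} [NormedAddCommGroup W] [InnerProductSpace ℝ W]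

theorem pd_congr {f g : Param n → V} {u : Param n} (h : f =ᶠ[𝓝 u] g) (i : Fin n) :
    pd i f u = pd i g u := by
  rw [pd, pd, h.fderiv_eq]

theorem pd_congr_on {f g : Param n → V} {U : Set (Param n)} (hU : IsOpen U)
    (h : ∀ w ∈ U, f w = g w) {u : Param n} (hu : u ∈ U) (i : Fin n) :
    pd i f u = pd i g u :=
  pd_congr (Filter.eventuallyEq_of_mem (hU.mem_nhds hu) h) i

theorem pd_const (c : V) (u : Param n) (i : Fin n) : pd i (fun _ => c) u = 0 := by
  simp [pd]

theorem pd_inner {f g : Param n → W} {u : Param n} (hf : DifferentiableAt ℝ f u)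
    (hg : DifferentiableAt ℝ g u) (i : Fin n) :
    pd i (fun w => ⟪f w, g w⟫) u = ⟪pd i f u, g u⟫ + ⟪f u, pd i g u⟫ := by
  rw [pd, fderiv_inner_apply (𝕜 := ℝ) hf hg, add_comm]; rfl

theorem pd_const_mul (c : ℝ) (f : Param n → ℝ) (u : Param n) (i : Fin n) :
    pd i (fun w => c * f w) u = c * pd i f u := by
  have h : fderiv ℝ (fun w => c • f w) u = c • fderiv ℝ f u := 
    congrFun (fderiv_const_smul_field (f := f) c) u
  simp only [smul_eq_mul] at h
  rw [pd, h]; rfl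

theorem pd_log {f : Param n → ℝ} {u : Param n} (hf : DifferentiableAt ℝ f u) (h0 : f u ≠ 0)
    (i : Fin n) : pd i (fun w => Real.log (f w)) u = (f u)⁻¹ * pd i f u := by
  rw [pd, fderiv.log hf h0]; rfl

theorem fderiv_apply_eq_sum_pd (f : Param n → V) (u v : Param n) :
    fderiv ℝ f u v = ∑ i, v i • pd i f u := by
  have hv : v = ∑ i, v i • EuclideanSpace.single i (1 : ℝ) := by
    have := (EuclideanSpace.basisFun (Fin n) ℝ).sum_repr v
    simpa using this.symm
  conv_lhs => rw [hv]
  simp [pd]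

theorem fderiv_eq_zero_of_pd {f : Param n → V} {u : Param n} (h : ∀ i, pd i f u = 0) :
    fderiv ℝ f u = 0 := by
  ext v; simp [fderiv_apply_eq_sum_pd, h]

theorem contDiffOn_pd {U : Set (Param n)} (hU : IsOpen U) {f : Param n → V}
    {k m : WithTop ℕ∞} (hf : ContDiffOn ℝ k f U) (hmk : m + 1 ≤ k) (i : Fin n) :
    ContDiffOn ℝ m (pd i f) U :=
  (hf.fderiv_of_isOpen hU hmk).clm_apply contDiffOn_const

theorem pd_pd {f : Param n → V} {u : Param n} (hf : DifferentiableAt ℝ (fderiv ℝ f) u)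
    (i j : Fin n) : pd j (pd i f) u =
      fderiv ℝ (fderiv ℝ f) u (EuclideanSpace.single j 1) (EuclideanSpace.single i 1) := by
  have h : HasFDerivAt (pd i f) _ u := hf.hasFDerivAt.clm_apply
    (hasFDerivAt_const (EuclideanSpace.single i (1 : ℝ)) u)
  rw [pd, h.fderiv]
  simp

theorem pd_comm {U : Set (Param n)} (hU : IsOpen U) {f : Param n → V} (hf : ContDiffOn ℝ 2 f U)
    {u : Param n} (hu : u ∈ U) (i j : Fin n) : pd j (pd i f) u = pd i (pd j f) u := by
  have hd : DifferentiableAt ℝ (fderiv ℝ f) u :=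
    ((hf.fderiv_of_isOpen (m := 1) hU (by norm_num)).differentiableOn one_ne_zero).differentiableAt
      (hU.mem_nhds hu)
  have hs : IsSymmSndFDerivAt ℝ f u :=
    (hf.contDiffAt (hU.mem_nhds hu)).isSymmSndFDerivAt (by simp)
  rw [pd_pd hd, pd_pd hd]
  exact hs _ _

/-- Jacobi's formula for the derivative of a determinant. -/
theorem hasFDerivAt_det {E ι : Type*} [NormedAddCommGroup E] [NormedSpace ℝ E] [Fintype ι]
    [DecidableEq ι] {M : E → Matrix ι ι ℝ} {u : E}
    (hM : ∀ i j, DifferentiableAt ℝ (fun w => M w i j) u) :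
    HasFDerivAt (fun w => (M w).det)
      (∑ i, ∑ j, (M u).adjugate i j • fderiv ℝ (fun w => M w j i) u) u := by
  let D : ContinuousMultilinearMap ℝ (fun _ : ι => ι → ℝ) ℝ :=
    ⟨(Matrix.detRowAlternating (R := ℝ) (n := ι)).toMultilinearMap, by
      change Continuous fun A : Matrix ι ι ℝ => A.det
      exact Continuous.matrix_det continuous_id⟩
  have hrow : ∀ i, HasFDerivAt (fun w => M w i)
      (ContinuousLinearMap.pi fun j => fderiv ℝ (fun w => M w i j) u) u :=
    fun i => hasFDerivAt_pi.2 fun j => (hM i j).hasFDerivAt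
  have h := HasFDerivAt.multilinear_comp D hrow
  refine h.congr_fderiv ?_
  ext v
  rw [Finset.sum_comm]
  simp only [sum_apply, ContinuousLinearMap.comp_apply,
    smul_apply]
  refine Finset.sum_congr rfl fun i _ => ?_
  -- By multilinearity, row i is replaced by its derivative; Cramer's rule expands the resulting
  -- determinant through the adjugate.
  change ((M u).updateRow i fun j => fderiv ℝ (fun w => M w i j) u v).det = _
  rw [← Matrix.cramer_transpose_apply, Matrix.cramer_eq_adjugate_mulVec,
    ← Matrix.adjugate_transpose]
  simp [Matrix.mulVec, dotProduct]

theorem pd_log_det {M : Param n → Matrix (Fin n) (Fin n) ℝ} {u : Param n}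
    (hM : ∀ i j, DifferentiableAt ℝ (fun w => M w i j) u) (h0 : (M u).det ≠ 0) (i : Fin n) :
    pd i (fun w => Real.log (M w).det) u =
      ∑ j, ∑ k, (M u)⁻¹ j k * pd i (fun w => M w k j) u := by
  have h := hasFDerivAt_det hM
  rw [pd_log h.differentiableAt h0, pd, h.fderiv]
  simp [Matrix.inv_def, Finset.mul_sum, pd, mul_assoc]

end Calculus

/-! ### Normals, covector and relative metric in Euclidean terms -/

section Geometry

theorem IsHypersurface.of_le {n : ℕ} {r r' : WithTop ℕ∞} {U : Set (Param n)}
    {x : Param n → Amb n} (hx : IsHypersurface r U x) (h : r' ≤ r) : IsHypersurface r' U x :=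
  { hx with contDiffOn := hx.contDiffOn.of_le h }

theorem IsRelNormalization.of_le {n : ℕ} {s s' : WithTop ℕ∞} {U : Set (Param n)}
    {x y : Param n → Amb n} (hy : IsRelNormalization s U x y) (h : s' ≤ s) :
    IsRelNormalization s' U x y :=
  { hy with contDiffOn := hy.contDiffOn.of_le h }

variable {n : ℕ} {U : Set (Param n)} {x ξ y : Param n → Amb n} {u : Param n}

theorem IsHypersurface.differentiableAt_pd (hx : IsHypersurface 3 U x) (hu : u ∈ U) (i : Fin n) :
    DifferentiableAt ℝ (pd i x) u :=
  ((contDiffOn_pd hx.isOpen hx.contDiffOn (m := 2) (by norm_num) i).differentiableOn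
    two_ne_zero).differentiableAt (hx.isOpen.mem_nhds hu)

theorem IsHypersurface.differentiableAt_pd_pd (hx : IsHypersurface 3 U x) (hu : u ∈ U)
    (i j : Fin n) : DifferentiableAt ℝ (pd j (pd i x)) u :=
  ((contDiffOn_pd hx.isOpen (contDiffOn_pd hx.isOpen hx.contDiffOn (m := 2) (by norm_num) i)
    (m := 1) (by norm_num) j).differentiableOn one_ne_zero).differentiableAt
    (hx.isOpen.mem_nhds hu)

theorem IsHypersurface.pd_pd_comm (hx : IsHypersurface 3 U x) (hu : u ∈ U) (i j : Fin n) :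
    pd j (pd i x) u = pd i (pd j x) u :=
  pd_comm hx.isOpen (hx.contDiffOn.of_le (by norm_num)) hu i j

theorem IsHypersurface.pd_pd_pd_comm (hx : IsHypersurface 3 U x) (hu : u ∈ U) (i j k : Fin n) :
    pd k (pd j (pd i x)) u = pd i (pd k (pd j x)) u := by
  rw [pd_congr_on hx.isOpen (fun w hw => hx.pd_pd_comm hw i j) hu k]
  exact pd_comm hx.isOpen (contDiffOn_pd hx.isOpen hx.contDiffOn (by norm_num) j) hu i k

theorem IsEuclNormalization.differentiableAt (hξ : IsEuclNormalization U x ξ) (hU : IsOpen U)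
    (hu : u ∈ U) : DifferentiableAt ℝ ξ u :=
  (hξ.contDiffOn.differentiableOn one_ne_zero).differentiableAt (hU.mem_nhds hu)

theorem IsRelNormalization.differentiableAt (hy : IsRelNormalization 1 U x y) (hU : IsOpen U)
    (hu : u ∈ U) : DifferentiableAt ℝ y u :=
  (hy.contDiffOn.differentiableOn one_ne_zero).differentiableAt (hU.mem_nhds hu)

theorem IsEuclNormalization.inner_eq_zero_of_mem_tangent (hξ : IsEuclNormalization U x ξ)
    (hu : u ∈ U) {v : Amb n} (hv : v ∈ tangent x u) : ⟪ξ u, v⟫ = 0 := by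
  have h : tangent x u ≤ (Submodule.span ℝ {ξ u})ᗮ := by
    rw [tangent, Submodule.span_le]
    rintro _ ⟨i, rfl⟩
    exact Submodule.mem_orthogonal_singleton_iff_inner_right.2 (hξ.normal u hu i)
  exact Submodule.mem_orthogonal_singleton_iff_inner_right.1 (h hv)

/-- The tangent space lies in the orthogonal complement of ξ, and both have dimension n by the
immersion property. -/
theorem IsEuclNormalization.mem_tangent_of_inner_eq_zero {r : WithTop ℕ∞}
    (hx : IsHypersurface r U x) (hξ : IsEuclNormalization U x ξ) (hu : u ∈ U) {v : Amb n}
    (hv : ⟪ξ u, v⟫ = 0) : v ∈ tangent x u := by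
  have h : tangent x u ≤ (Submodule.span ℝ {ξ u})ᗮ := fun w hw =>
    Submodule.mem_orthogonal_singleton_iff_inner_right.2 (hξ.inner_eq_zero_of_mem_tangent hu hw)
  have h0 : ξ u ≠ 0 := fun h0 => by simpa [h0] using hξ.norm_eq_one u hu
  have : Fact (Module.finrank ℝ (Amb n) = n + 1) := ⟨by simp⟩
  have he : tangent x u = (Submodule.span ℝ {ξ u})ᗮ := by
    refine Submodule.eq_of_le_of_finrank_eq h ?_
    rw [Submodule.finrank_orthogonal_span_singleton (n := n) h0, tangent,
      finrank_span_eq_card (hx.immersion u hu), Fintype.card_fin]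
  rw [he]
  exact Submodule.mem_orthogonal_singleton_iff_inner_right.2 hv

theorem mem_tangent_iff {v : Amb n} :
    v ∈ tangent x u ↔ ∃ c : Fin n → ℝ, ∑ i, c i • pd i x u = v :=
  Submodule.mem_span_range_iff_exists_fun ℝ

theorem support_ne_zero {r s : WithTop ℕ∞} (hx : IsHypersurface r U x)
    (hξ : IsEuclNormalization U x ξ) (hy : IsRelNormalization s U x y) (hu : u ∈ U) :
    support ξ y u ≠ 0 := fun h =>
  hy.not_mem_tangent u hu (hξ.mem_tangent_of_inner_eq_zero hx hu h)

/-- Both vectors are normal to the tangent hyperplane, and ⟨X, y⟩ = 1 fixes the factor. Regularity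
of the covector, which is defined by choice, and all later reductions to h and q rest on this. -/
theorem covector_eq {r s : WithTop ℕ∞} (hx : IsHypersurface r U x)
    (hξ : IsEuclNormalization U x ξ) (hy : IsRelNormalization s U x y) (hu : u ∈ U) :
    covector x y u = (support ξ y u)⁻¹ • ξ u := by
  refine (covector_unique (hx.immersion u hu) (hy.not_mem_tangent u hu) ⟨fun i => ?_, ?_⟩).symm
  · rw [real_inner_smul_left, hξ.normal u hu i, mul_zero]
  · rw [real_inner_smul_left]
    exact inv_mul_cancel₀ (support_ne_zero hx hξ hy hu)

theorem relMetric_eq {r s : WithTop ℕ∞} (hx : IsHypersurface r U x)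
    (hξ : IsEuclNormalization U x ξ) (hy : IsRelNormalization s U x y) (hu : u ∈ U) :
    relMetric x y u = (support ξ y u)⁻¹ • secondForm x ξ u := by
  ext i j
  simp [relMetric, secondForm, covector_eq hx hξ hy hu, real_inner_smul_left]

theorem secondForm_symm (hx : IsHypersurface 3 U x) (hu : u ∈ U) (i j : Fin n) :
    secondForm x ξ u i j = secondForm x ξ u j i := by
  simp [secondForm, hx.pd_pd_comm hu i j]

theorem relMetric_symm (hx : IsHypersurface 3 U x) (hu : u ∈ U) (i j : Fin n) :
    relMetric x y u i j = relMetric x y u j i := by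
  simp [relMetric, hx.pd_pd_comm hu i j]

/-- Differentiate ⟨ξ, x_{/i}⟩ = 0. -/
theorem inner_pd_normal_pd (hx : IsHypersurface 3 U x) (hξ : IsEuclNormalization U x ξ)
    (hu : u ∈ U) (i j : Fin n) : ⟪pd j ξ u, pd i x u⟫ = -secondForm x ξ u i j := by
  have h := pd_inner (hξ.differentiableAt hx.isOpen hu) (hx.differentiableAt_pd hu i) j
  rw [pd_congr_on hx.isOpen (fun w hw => hξ.normal w hw i) hu, pd_const] at h
  simp only [secondForm, Matrix.of_apply]
  linarith

/-- Differentiate ⟨ξ, ξ⟩ = 1; hence the derivatives of ξ are tangential. -/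
theorem inner_normal_pd_normal (hU : IsOpen U) (hξ : IsEuclNormalization U x ξ)
    (hu : u ∈ U) (j : Fin n) : ⟪ξ u, pd j ξ u⟫ = 0 := by
  have h := pd_inner (hξ.differentiableAt hU hu) (hξ.differentiableAt hU hu) j
  have h1 : ∀ w ∈ U, ⟪ξ w, ξ w⟫ = (1 : ℝ) := fun w hw => by
    rw [real_inner_self_eq_norm_sq, hξ.norm_eq_one w hw, one_pow]
  rw [pd_congr_on hU h1 hu, pd_const, real_inner_comm] at h
  linarith

theorem det_secondForm_ne_zero (hK : gaussCurv x ξ u ≠ 0) : (secondForm x ξ u).det ≠ 0 :=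
  fun h => hK (by simp [gaussCurv, h])

theorem det_firstForm_ne_zero (hK : gaussCurv x ξ u ≠ 0) : (firstForm x u).det ≠ 0 :=
  fun h => hK (by simp [gaussCurv, h])

theorem differentiableAt_firstForm (hx : IsHypersurface 3 U x) (hu : u ∈ U) (i j : Fin n) :
    DifferentiableAt ℝ (fun w => firstForm x w i j) u :=
  (hx.differentiableAt_pd hu i).inner ℝ (hx.differentiableAt_pd hu j)

theorem differentiableAt_secondForm (hx : IsHypersurface 3 U x) (hξ : IsEuclNormalization U x ξ)
    (hu : u ∈ U) (i j : Fin n) : DifferentiableAt ℝ (fun w => secondForm x ξ w i j) u :=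
  (hξ.differentiableAt hx.isOpen hu).inner ℝ (hx.differentiableAt_pd_pd hu i j)

theorem differentiableAt_support (hU : IsOpen U) (hξ : IsEuclNormalization U x ξ)
    (hy : IsRelNormalization 1 U x y) (hu : u ∈ U) : DifferentiableAt ℝ (support ξ y) u :=
  (hξ.differentiableAt hU hu).inner ℝ (hy.differentiableAt hU hu)

theorem differentiableAt_covector (hx : IsHypersurface 3 U x) (hξ : IsEuclNormalization U x ξ)
    (hy : IsRelNormalization 1 U x y) (hu : u ∈ U) : DifferentiableAt ℝ (covector x y) u := by
  have h : DifferentiableAt ℝ (fun w => (support ξ y w)⁻¹ • ξ w) u :=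
    ((differentiableAt_support hx.isOpen hξ hy hu).inv (support_ne_zero hx hξ hy hu)).smul
      (hξ.differentiableAt hx.isOpen hu)
  exact h.congr_of_eventuallyEq
    (eventuallyEq_of_mem (hx.isOpen.mem_nhds hu) fun w hw => covector_eq hx hξ hy hw)

theorem pd_covector (hx : IsHypersurface 3 U x) (hξ : IsEuclNormalization U x ξ)
    (hy : IsRelNormalization 1 U x y) (hu : u ∈ U) (i : Fin n) :
    pd i (covector x y) u = (support ξ y u)⁻¹ • pd i ξ u -
      (((support ξ y u) ^ 2)⁻¹ * pd i (support ξ y) u) • ξ u := by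
  have hq := (differentiableAt_support hx.isOpen hξ hy hu)
  have hq0 := support_ne_zero hx hξ hy hu
  have h : HasFDerivAt (fun w => (support ξ y w)⁻¹ • ξ w) _ u :=
    ((hasDerivAt_inv hq0).comp_hasFDerivAt u hq.hasFDerivAt).smul (hξ.differentiableAt hx.isOpen hu).hasFDerivAt
  rw [pd_congr_on hx.isOpen (fun w hw => covector_eq hx hξ hy hw) hu, pd, h.fderiv]
  simp [pd, sub_eq_add_neg, neg_smul]

theorem differentiableAt_relMetric (hx : IsHypersurface 3 U x) (hξ : IsEuclNormalization U x ξ)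
    (hy : IsRelNormalization 1 U x y) (hu : u ∈ U) (i j : Fin n) :
    DifferentiableAt ℝ (fun w => relMetric x y w i j) u :=
  (differentiableAt_covector hx hξ hy hu).inner ℝ (hx.differentiableAt_pd_pd hu i j)

theorem pd_relMetric (hx : IsHypersurface 3 U x) (hξ : IsEuclNormalization U x ξ)
    (hy : IsRelNormalization 1 U x y) (hu : u ∈ U) (i j k : Fin n) :
    pd k (fun w => relMetric x y w i j) u =
      ⟪pd k (covector x y) u, pd j (pd i x) u⟫ + ⟪covector x y u, pd k (pd j (pd i x)) u⟫ :=
  pd_inner (differentiableAt_covector hx hξ hy hu) (hx.differentiableAt_pd_pd hu i j) k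

theorem det_relMetric (hx : IsHypersurface 3 U x) (hξ : IsEuclNormalization U x ξ)
    (hy : IsRelNormalization 1 U x y) (hu : u ∈ U) :
    (relMetric x y u).det = (support ξ y u)⁻¹ ^ n * (secondForm x ξ u).det := by
  rw [relMetric_eq hx hξ hy hu, Matrix.det_smul, Fintype.card_fin]

theorem det_relMetric_ne_zero (hx : IsHypersurface 3 U x) (hξ : IsEuclNormalization U x ξ)
    (hK : gaussCurv x ξ u ≠ 0) (hy : IsRelNormalization 1 U x y) (hu : u ∈ U) :
    (relMetric x y u).det ≠ 0 := by
  rw [det_relMetric hx hξ hy hu]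
  exact mul_ne_zero (pow_ne_zero _ (inv_ne_zero (support_ne_zero hx hξ hy hu)))
    (det_secondForm_ne_zero hK)

theorem relMetric_inv (hx : IsHypersurface 3 U x) (hξ : IsEuclNormalization U x ξ)
    (hK : gaussCurv x ξ u ≠ 0) (hy : IsRelNormalization 1 U x y) (hu : u ∈ U) :
    (relMetric x y u)⁻¹ = support ξ y u • (secondForm x ξ u)⁻¹ := by
  have hq0 := support_ne_zero hx hξ hy hu
  refine Matrix.inv_eq_right_inv ?_
  rw [relMetric_eq hx hξ hy hu, Matrix.smul_mul, Matrix.mul_smul, smul_smul,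
    inv_mul_cancel₀ hq0, one_smul, Matrix.mul_nonsing_inv _ (det_secondForm_ne_zero hK).isUnit]

/-! ### The Darboux tensor and its trace -/

/-- Lowering the upper index cancels the inverse metric and leaves the Christoffel symbols of the
first kind. -/
theorem sum_christoffel_mul {G : Param n → Matrix (Fin n) (Fin n) ℝ}
    (hG : ∀ i j, G u i j = G u j i) (h0 : (G u).det ≠ 0) (i j k : Fin n) :
    ∑ m, christoffel G m i j u * G u m k = (1 / 2) * (pd i (fun w => G w k j) u +
      pd j (fun w => G w k i) u - pd k (fun w => G w i j) u) := by
  have hinv : ∀ l, ∑ m, G u k m * (G u)⁻¹ m l = (1 : Matrix (Fin n) (Fin n) ℝ) k l := fun l => by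
    rw [← Matrix.mul_nonsing_inv _ h0.isUnit, Matrix.mul_apply]
  set c : Fin n → ℝ := fun l =>
    pd i (fun w => G w l j) u + pd j (fun w => G w l i) u - pd l (fun w => G w i j) u with hc
  calc ∑ m, christoffel G m i j u * G u m k
      = ∑ m, ∑ l, (1 / 2) * (G u k m * (G u)⁻¹ m l * c l) := by
        refine Finset.sum_congr rfl fun m _ => ?_
        rw [christoffel, hG m k, Finset.mul_sum, Finset.sum_mul]
        exact Finset.sum_congr rfl fun l _ => by rw [hc]; ring
    _ = (1 / 2) * ∑ l, (∑ m, G u k m * (G u)⁻¹ m l) * c l := by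
        rw [Finset.sum_comm, Finset.mul_sum]
        simp_rw [Finset.sum_mul, Finset.mul_sum]
    _ = _ := by simp [hinv, Matrix.one_apply, hc]

/-- The three lowered Christoffel symbols add up to half the cyclic sum of the derivatives of G.
Expanding G_{ij/k} and G_{ik/j} by the product rule cancels ⟨X, x_{/ijk}⟩; G_{jk/i} is kept for
Jacobi's formula. -/
theorem darboux_eq (hx : IsHypersurface 3 U x) (hξ : IsEuclNormalization U x ξ)
    (hK : gaussCurv x ξ u ≠ 0) (hy : IsRelNormalization 1 U x y) (hu : u ∈ U) (i j k : Fin n) :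
    darboux x y i j k u = -(1 / 2) * (pd i (fun w => relMetric x y w j k) u +
      ⟪pd j (covector x y) u, pd i (pd k x) u⟫ + ⟪pd k (covector x y) u, pd j (pd i x) u⟫) := by
  have hX : ∀ m, ⟪covector x y u, pd m x u⟫ = 0 :=
    (covector_spec (hy.not_mem_tangent u hu)).1
  have hXX : ∀ i j, ⟪covector x y u, pd j (pd i x) u⟫ = relMetric x y u i j := fun _ _ => rfl
  have hcov : ∀ i j, ⟪covector x y u, covHess (relMetric x y) x i j u⟫ = relMetric x y u i j := by
    intro i j
    simp [covHess, inner_sub_right, inner_sum, real_inner_smul_right, hX, hXX]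
  have hsymm : ∀ i j k, pd k (fun w => relMetric x y w i j) u =
      pd k (fun w => relMetric x y w j i) u := fun i j k =>
    pd_congr_on hx.isOpen (fun w hw => relMetric_symm hx hw i j) hu k
  -- X annihilates the tangential terms, including those with derivatives of the Christoffel
  -- symbols.
  have hd : darboux x y i j k u = ⟪covector x y u, pd k (pd j (pd i x)) u⟫ -
      ∑ m, christoffel (relMetric x y) m i j u * relMetric x y u m k -
      (∑ m, christoffel (relMetric x y) m k i u * relMetric x y u m j +
      ∑ m, christoffel (relMetric x y) m k j u * relMetric x y u m i) := by
    simp only [darboux, covThird, dCovHess, inner_sub_right, inner_sum, inner_add_right,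
      real_inner_smul_right, hX, hXX, hcov, mul_zero, add_zero, Finset.sum_add_distrib, Finset.sum_const_zero,
      relMetric_symm hx hu i]
  have hS := fun i j k => sum_christoffel_mul (relMetric_symm (y := y) hx hu)
    (det_relMetric_ne_zero hx hξ hK hy hu) i j k
  rw [hd, hS, hS, hS, hsymm k j i, hsymm k i j, hsymm j i k, pd_relMetric hx hξ hy hu i j k,
    pd_relMetric hx hξ hy hu i k j, pd_relMetric hx hξ hy hu j k i,
    ← hx.pd_pd_pd_comm hu i j k, hx.pd_pd_comm hu i k]
  have h3 : pd j (pd k (pd i x)) u = pd k (pd j (pd i x)) u :=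
    pd_comm hx.isOpen (contDiffOn_pd hx.isOpen hx.contDiffOn (by norm_num) i) hu k j
  rw [h3]
  ring

theorem secondForm_inv_symm (hx : IsHypersurface 3 U x) (hu : u ∈ U) (i j : Fin n) :
    (secondForm x ξ u)⁻¹ i j = (secondForm x ξ u)⁻¹ j i := by
  have h : (secondForm x ξ u).transpose = secondForm x ξ u := by
    ext i j; exact secondForm_symm hx hu j i
  conv_lhs => rw [← h, ← Matrix.transpose_nonsing_inv]
  rfl

/-- Contraction of the Weingarten equations with the derivatives of the tangent frame. -/
theorem sum_secondForm_inv_mul (hx : IsHypersurface 3 U x) (hξ : IsEuclNormalization U x ξ)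
    (hK : gaussCurv x ξ u ≠ 0) (hu : u ∈ U) (i : Fin n) :
    ∑ j, ∑ k, (secondForm x ξ u)⁻¹ j k * ⟪pd j ξ u, pd i (pd k x) u⟫ =
      -(1 / 2) * pd i (fun w => Real.log (firstForm x w).det) u := by
  have hmem : ∀ j, ∃ c : Fin n → ℝ, ∑ m, c m • pd m x u = pd j ξ u := fun j =>
    mem_tangent_iff.1 (hξ.mem_tangent_of_inner_eq_zero hx hu
      (inner_normal_pd_normal hx.isOpen hξ hu j))
  choose c hc using hmem
  let C : Matrix (Fin n) (Fin n) ℝ := Matrix.of fun m j => c j m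
  -- C holds the coefficients of ξ_{/j} in the tangent frame, so gC = -h, and contracting with h⁻¹
  -- leaves -g⁻¹.
  have hgC : firstForm x u * C = -secondForm x ξ u := by
    ext k j
    rw [Matrix.neg_apply, ← inner_pd_normal_pd hx hξ hu, ← hc j, sum_inner, Matrix.mul_apply]
    simp only [firstForm, C, Matrix.of_apply, real_inner_smul_left]
    exact Finset.sum_congr rfl fun m _ => by rw [mul_comm, real_inner_comm]
  have hCh : C * (secondForm x ξ u)⁻¹ = -(firstForm x u)⁻¹ := by
    have hg := Matrix.nonsing_inv_mul _ (det_firstForm_ne_zero hK).isUnit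
    have hh := Matrix.mul_nonsing_inv _ (det_secondForm_ne_zero hK).isUnit
    rw [← Matrix.one_mul C, ← hg, Matrix.mul_assoc _ _ C, hgC, Matrix.mul_neg, Matrix.neg_mul,
      Matrix.mul_assoc, hh, Matrix.mul_one]
  have hCh' : ∀ m k, ∑ j, c j m * (secondForm x ξ u)⁻¹ j k = -(firstForm x u)⁻¹ m k :=
    fun m k => by
      rw [← Matrix.neg_apply, ← hCh, Matrix.mul_apply]; rfl
  have hgs : ∀ m k, (firstForm x u)⁻¹ m k = (firstForm x u)⁻¹ k m := fun m k => by
    have h : (firstForm x u).transpose = firstForm x u := by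
      ext i j; exact real_inner_comm (pd i x u) (pd j x u)
    conv_lhs => rw [← h, ← Matrix.transpose_nonsing_inv]
    rfl
  have hl : ∑ j, ∑ k, (secondForm x ξ u)⁻¹ j k * ⟪pd j ξ u, pd i (pd k x) u⟫ =
      -∑ m, ∑ k, (firstForm x u)⁻¹ m k * ⟪pd m x u, pd i (pd k x) u⟫ := by
    calc _ = ∑ j, ∑ k, ∑ m, c j m * (secondForm x ξ u)⁻¹ j k * ⟪pd m x u, pd i (pd k x) u⟫ := by
          refine Finset.sum_congr rfl fun j _ => Finset.sum_congr rfl fun k _ => ?_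
          rw [← hc j, sum_inner, Finset.mul_sum]
          exact Finset.sum_congr rfl fun m _ => by rw [real_inner_smul_left]; ring
      _ = ∑ m, ∑ k, ∑ j, c j m * (secondForm x ξ u)⁻¹ j k * ⟪pd m x u, pd i (pd k x) u⟫ :=
          (Finset.sum_comm.trans (Finset.sum_congr rfl fun k _ => Finset.sum_comm)).trans
            Finset.sum_comm
      _ = _ := by
          simp_rw [← Finset.sum_mul, hCh', neg_mul, Finset.sum_neg_distrib]
  have hd : ∀ j k, pd i (fun w => firstForm x w k j) u =
      ⟪pd i (pd k x) u, pd j x u⟫ + ⟪pd k x u, pd i (pd j x) u⟫ := fun j k =>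
    pd_inner (hx.differentiableAt_pd hu k) (hx.differentiableAt_pd hu j) i
  rw [hl, pd_log_det (differentiableAt_firstForm hx hu) (det_firstForm_ne_zero hK)]
  simp_rw [hd, mul_add, Finset.sum_add_distrib]
  -- By symmetry of g⁻¹ the two halves of the derivative of g contribute equally, whence the factor
  -- 1/2.
  have hswap : ∑ j, ∑ k, (firstForm x u)⁻¹ j k * ⟪pd k x u, pd i (pd j x) u⟫ =
      ∑ j, ∑ k, (firstForm x u)⁻¹ j k * ⟪pd i (pd k x) u, pd j x u⟫ := by
    rw [Finset.sum_comm]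
    refine Finset.sum_congr rfl fun j _ => Finset.sum_congr rfl fun k _ => ?_
    rw [hgs, real_inner_comm]
  rw [hswap]
  simp_rw [real_inner_comm (pd i (pd _ x) u)]
  ring

/-- `(n + 2) log |q| - log |K|`, so that `φ = exp (logRatio / (2n))`. -/
noncomputable def logRatio (x ξ y : Param n → Amb n) (u : Param n) : ℝ :=
  ((n : ℝ) + 2) * Real.log (support ξ y u) - Real.log (secondForm x ξ u).det +
    Real.log (firstForm x u).det

/-- `Real.log` ignores signs, so the signs of q and det h need no case distinction. -/
theorem logRatio_eq (hK : gaussCurv x ξ u ≠ 0) : logRatio x ξ y u =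
    ((n : ℝ) + 2) * Real.log |support ξ y u| - Real.log |gaussCurv x ξ u| := by
  rw [Real.log_abs, Real.log_abs, gaussCurv, Real.log_div (det_secondForm_ne_zero hK)
    (det_firstForm_ne_zero hK), logRatio]
  ring

theorem hasFDerivAt_logRatio (hx : IsHypersurface 3 U x) (hξ : IsEuclNormalization U x ξ)
    (hK : gaussCurv x ξ u ≠ 0) (hy : IsRelNormalization 1 U x y) (hu : u ∈ U) :
    HasFDerivAt (logRatio x ξ y)
      (((n : ℝ) + 2) • fderiv ℝ (fun w => Real.log (support ξ y w)) u -
        fderiv ℝ (fun w => Real.log (secondForm x ξ w).det) u +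
        fderiv ℝ (fun w => Real.log (firstForm x w).det) u) u := by
  have h1 := (differentiableAt_support hx.isOpen hξ hy hu).log (support_ne_zero hx hξ hy hu)
  have h2 := (hasFDerivAt_det
    (differentiableAt_secondForm hx hξ hu)).differentiableAt.log (det_secondForm_ne_zero hK)
  have h3 := (hasFDerivAt_det
    (differentiableAt_firstForm hx hu)).differentiableAt.log (det_firstForm_ne_zero hK)
  exact ((h1.hasFDerivAt.const_mul _).sub h2.hasFDerivAt).add h3.hasFDerivAt

theorem pd_log_det_relMetric (hx : IsHypersurface 3 U x) (hξ : IsEuclNormalization U x ξ)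
    (hK : ∀ u ∈ U, gaussCurv x ξ u ≠ 0) (hy : IsRelNormalization 1 U x y) (hu : u ∈ U)
    (i : Fin n) : pd i (fun w => Real.log (relMetric x y w).det) u =
      pd i (fun w => Real.log (secondForm x ξ w).det) u -
        n * pd i (fun w => Real.log (support ξ y w)) u := by
  have h1 := (differentiableAt_support hx.isOpen hξ hy hu).log (support_ne_zero hx hξ hy hu)
  have h2 := (hasFDerivAt_det (differentiableAt_secondForm hx hξ hu)).differentiableAt.log
    (det_secondForm_ne_zero (hK u hu))
  have he : ∀ w ∈ U, Real.log (relMetric x y w).det =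
      Real.log (secondForm x ξ w).det - n * Real.log (support ξ y w) := fun w hw => by
    have hq0 := support_ne_zero hx hξ hy hw
    rw [det_relMetric hx hξ hy hw, Real.log_mul (pow_ne_zero _ (inv_ne_zero hq0))
      (det_secondForm_ne_zero (hK w hw)), Real.log_pow, Real.log_inv]
    ring
  rw [pd_congr_on hx.isOpen he hu, pd,
    (h2.hasFDerivAt.fun_sub (h1.hasFDerivAt.const_mul _)).fderiv]
  simp [pd]

/-- In X_{/j} = q⁻¹ ξ_{/j} - q⁻² q_{/j} ξ, the first term gives the Weingarten contraction; in the
second, h^{jk} h_{ki} = δ leaves -q_{/i}/q. -/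
theorem sum_inv_mul_inner_pd_covector (hx : IsHypersurface 3 U x)
    (hξ : IsEuclNormalization U x ξ) (hK : gaussCurv x ξ u ≠ 0)
    (hy : IsRelNormalization 1 U x y) (hu : u ∈ U) (i : Fin n) :
    ∑ j, ∑ k, (relMetric x y u)⁻¹ j k * ⟪pd j (covector x y) u, pd i (pd k x) u⟫ =
      -(1 / 2) * pd i (fun w => Real.log (firstForm x w).det) u -
        pd i (fun w => Real.log (support ξ y w)) u := by
  have hq0 := support_ne_zero hx hξ hy hu
  have hterm : ∀ j k, (relMetric x y u)⁻¹ j k * ⟪pd j (covector x y) u, pd i (pd k x) u⟫ =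
      (secondForm x ξ u)⁻¹ j k * ⟪pd j ξ u, pd i (pd k x) u⟫ -
      (support ξ y u)⁻¹ * pd j (support ξ y) u *
        ((secondForm x ξ u)⁻¹ j k * secondForm x ξ u k i) := fun j k => by
    have hs : ⟪ξ u, pd i (pd k x) u⟫ = secondForm x ξ u k i := rfl
    rw [relMetric_inv hx hξ hK hy hu, pd_covector hx hξ hy hu, inner_sub_left,
      real_inner_smul_left, real_inner_smul_left, hs, Matrix.smul_apply, smul_eq_mul]
    field_simp
  have hinv : ∀ j, ∑ k, (secondForm x ξ u)⁻¹ j k * secondForm x ξ u k i =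
      (1 : Matrix (Fin n) (Fin n) ℝ) j i := fun j => by
    rw [← Matrix.nonsing_inv_mul _ (det_secondForm_ne_zero hK).isUnit, Matrix.mul_apply]
  simp_rw [hterm, Finset.sum_sub_distrib, sum_secondForm_inv_mul hx hξ hK hu, ← Finset.mul_sum,
    hinv]
  rw [pd_log (differentiableAt_support hx.isOpen hξ hy hu) hq0]
  simp [Matrix.one_apply]

/-- The trace of the Darboux tensor is a logarithmic derivative. -/
theorem sum_darboux_mul (hx : IsHypersurface 3 U x) (hξ : IsEuclNormalization U x ξ)
    (hK : ∀ u ∈ U, gaussCurv x ξ u ≠ 0) (hy : IsRelNormalization 1 U x y) (hu : u ∈ U)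
    (i : Fin n) : ∑ j, ∑ k, darboux x y i j k u * (relMetric x y u)⁻¹ j k =
      (1 / 2) * pd i (logRatio x ξ y) u := by
  have hKu := hK u hu
  have hsymm : ∀ j k, (relMetric x y u)⁻¹ j k = (relMetric x y u)⁻¹ k j := fun j k => by
    simp only [relMetric_inv hx hξ hKu hy hu, Matrix.smul_apply, secondForm_inv_symm hx hu j k]
  have h1 := pd_log_det (differentiableAt_relMetric hx hξ hy hu)
    (det_relMetric_ne_zero hx hξ hKu hy hu) i
  rw [pd_log_det_relMetric hx hξ hK hy hu] at h1
  have h2 := sum_inv_mul_inner_pd_covector hx hξ hKu hy hu i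
  have h3 : ∑ j, ∑ k, (relMetric x y u)⁻¹ j k * ⟪pd k (covector x y) u, pd j (pd i x) u⟫ =
      ∑ j, ∑ k, (relMetric x y u)⁻¹ j k * ⟪pd j (covector x y) u, pd i (pd k x) u⟫ := by
    rw [Finset.sum_comm]
    refine Finset.sum_congr rfl fun j _ => Finset.sum_congr rfl fun k _ => ?_
    rw [hsymm, hx.pd_pd_comm hu i k]
  have h4 : ∑ j, ∑ k, (relMetric x y u)⁻¹ j k * pd i (fun w => relMetric x y w j k) u =
      ∑ j, ∑ k, (relMetric x y u)⁻¹ j k * pd i (fun w => relMetric x y w k j) u := by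
    refine Finset.sum_congr rfl fun j _ => Finset.sum_congr rfl fun k _ => ?_
    rw [pd_congr_on hx.isOpen (fun w hw => relMetric_symm hx hw j k) hu]
  have hterm : ∀ j k, darboux x y i j k u * (relMetric x y u)⁻¹ j k = -(1 / 2) *
      ((relMetric x y u)⁻¹ j k * pd i (fun w => relMetric x y w j k) u +
      (relMetric x y u)⁻¹ j k * ⟪pd j (covector x y) u, pd i (pd k x) u⟫ +
      (relMetric x y u)⁻¹ j k * ⟪pd k (covector x y) u, pd j (pd i x) u⟫) := fun j k => by
    rw [darboux_eq hx hξ hKu hy hu]; ring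
  simp_rw [hterm, ← Finset.mul_sum, Finset.sum_add_distrib]
  rw [h3, h4, ← h1, h2]
  have hL : pd i (logRatio x ξ y) u = ((n : ℝ) + 2) * pd i (fun w => Real.log (support ξ y w)) u -
      pd i (fun w => Real.log (secondForm x ξ w).det) u +
      pd i (fun w => Real.log (firstForm x w).det) u := by
    rw [pd, (hasFDerivAt_logRatio hx hξ hKu hy hu).fderiv]; rfl
  rw [hL]
  ring

/-! ### The Tchebychev vector field against the derivative of the normal -/

theorem inner_tchebychev_pd (hx : IsHypersurface 3 U x) (hξ : IsEuclNormalization U x ξ)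
    (hK : ∀ u ∈ U, gaussCurv x ξ u ≠ 0) (hy : IsRelNormalization 1 U x y) (hu : u ∈ U)
    (l : Fin n) : ⟪tchebychev x y u, pd l ξ u⟫ =
      -(support ξ y u / (2 * n)) * pd l (logRatio x ξ y) u := by
  have hKu := hK u hu
  have hq0 := support_ne_zero hx hξ hy hu
  have hinv : ∀ i, ∑ m, (secondForm x ξ u)⁻¹ i m * secondForm x ξ u m l =
      (1 : Matrix (Fin n) (Fin n) ℝ) i l := fun i => by
    rw [← Matrix.nonsing_inv_mul _ (det_secondForm_ne_zero hKu).isUnit, Matrix.mul_apply]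
  have h : ∀ i, ∑ j, ∑ k, ∑ m, darboux x y i j k u * (relMetric x y u)⁻¹ j k *
      (relMetric x y u)⁻¹ i m * ⟪pd m x u, pd l ξ u⟫ =
      -support ξ y u * ((1 / 2) * pd i (logRatio x ξ y) u *
        (1 : Matrix (Fin n) (Fin n) ℝ) i l) := fun i => by
    -- G^{im} = q h^{im} meets ⟨x_{/m}, ξ_{/l}⟩ = -h_{ml}, leaving -q δ.
    have hm : ∑ m, (relMetric x y u)⁻¹ i m * ⟪pd m x u, pd l ξ u⟫ =
        -support ξ y u * (1 : Matrix (Fin n) (Fin n) ℝ) i l := by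
      rw [← hinv i, Finset.mul_sum]
      refine Finset.sum_congr rfl fun m _ => ?_
      rw [real_inner_comm, inner_pd_normal_pd hx hξ hu, relMetric_inv hx hξ hKu hy hu,
        Matrix.smul_apply, smul_eq_mul]
      ring
    simp_rw [mul_assoc (_ * _) ((relMetric x y u)⁻¹ i _), ← Finset.mul_sum, hm, ← Finset.sum_mul,
      sum_darboux_mul hx hξ hK hy hu i]
    ring
  simp_rw [tchebychev, real_inner_smul_left, sum_inner, real_inner_smul_left, h]
  rw [← Finset.mul_sum]
  simp only [Matrix.one_apply, mul_ite, mul_one, mul_zero, Finset.sum_ite_eq', Finset.mem_univ,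
    if_true]
  -- For n = 0 both sides are zero, since division by zero gives zero.
  rcases eq_or_ne (n : ℝ) 0 with h0 | h0
  · simp [h0]
  · field_simp

theorem inner_tchebychev_fderiv_eq_zero_iff (hn : 1 ≤ n) (hx : IsHypersurface 3 U x)
    (hξ : IsEuclNormalization U x ξ) (hK : ∀ u ∈ U, gaussCurv x ξ u ≠ 0)
    (hy : IsRelNormalization 1 U x y) (hu : u ∈ U) :
    (∀ v, ⟪tchebychev x y u, fderiv ℝ ξ u v⟫ = 0) ↔ fderiv ℝ (logRatio x ξ y) u = 0 := by
  have hn0 : (n : ℝ) ≠ 0 := by positivity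
  have hq0 := support_ne_zero hx hξ hy hu
  constructor
  · intro h
    refine fderiv_eq_zero_of_pd fun l => ?_
    have hl := inner_tchebychev_pd hx hξ hK hy hu l
    rw [show pd l ξ u = fderiv ℝ ξ u _ from rfl, h] at hl
    exact (mul_eq_zero.1 hl.symm).resolve_left
      (neg_ne_zero.2 (div_ne_zero hq0 (mul_ne_zero two_ne_zero hn0)))
  · intro h v
    rw [fderiv_apply_eq_sum_pd, inner_sum]
    refine Finset.sum_eq_zero fun l _ => ?_
    rw [real_inner_smul_right, inner_tchebychev_pd hx hξ hK hy hu, pd, h]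
    simp

/-! ### Recovering the normalization from its support function -/

theorem pd_support (hx : IsHypersurface 3 U x) (hξ : IsEuclNormalization U x ξ)
    (hy : IsRelNormalization 1 U x y) (hu : u ∈ U) (i : Fin n) :
    pd i (support ξ y) u = ⟪pd i ξ u, y u⟫ := by
  have h := pd_inner (hξ.differentiableAt hx.isOpen hu) (hy.differentiableAt hx.isOpen hu) i
  rw [hξ.inner_eq_zero_of_mem_tangent hu (hy.pd_mem_tangent u hu i), add_zero] at h
  exact h

/-- A relative normalization is determined by its support function. -/
theorem eq_normalizationOfSupport (hx : IsHypersurface 3 U x) (hξ : IsEuclNormalization U x ξ)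
    (hK : gaussCurv x ξ u ≠ 0) (hy : IsRelNormalization 1 U x y) (hu : u ∈ U) :
    y u = normalizationOfSupport x ξ (support ξ y) u := by
  have hnorm : ⟪ξ u, ξ u⟫ = (1 : ℝ) := by
    rw [real_inner_self_eq_norm_sq, hξ.norm_eq_one u hu, one_pow]
  have hmem : y u - support ξ y u • ξ u ∈ tangent x u := by
    refine hξ.mem_tangent_of_inner_eq_zero hx hu ?_
    rw [inner_sub_right, real_inner_smul_right, hnorm, mul_one]
    exact sub_self _
  obtain ⟨c, hc⟩ := mem_tangent_iff.1 hmem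
  -- Only the tangential part of y pairs with ξ_{/i}, so q_{/i} = -h_{ij} cʲ; inverting h recovers
  -- the coefficients c.
  have hpd : ∀ i, pd i (support ξ y) u = -∑ j, secondForm x ξ u i j * c j := fun i => by
    rw [pd_support hx hξ hy hu, ← sub_add_cancel (y u) (support ξ y u • ξ u), ← hc,
      inner_add_right, real_inner_smul_right, real_inner_comm (ξ u),
      inner_normal_pd_normal hx.isOpen hξ hu, mul_zero, add_zero, inner_sum,
      ← Finset.sum_neg_distrib]
    refine Finset.sum_congr rfl fun j _ => ?_
    rw [real_inner_smul_right, inner_pd_normal_pd hx hξ hu, secondForm_symm hx hu]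
    ring
  have hcj : ∀ j, ∑ i, (secondForm x ξ u)⁻¹ i j * pd i (support ξ y) u = -c j := fun j => by
    have h1 : (secondForm x ξ u)⁻¹.mulVec ((secondForm x ξ u).mulVec c) = c := by
      rw [Matrix.mulVec_mulVec, Matrix.nonsing_inv_mul _ (det_secondForm_ne_zero hK).isUnit,
        Matrix.one_mulVec]
    have h2 := congrFun h1 j
    simp_rw [hpd, secondForm_inv_symm hx hu _ j, mul_neg, Finset.sum_neg_distrib]
    exact congrArg _ h2
  rw [normalizationOfSupport, Finset.sum_comm]
  simp_rw [← Finset.sum_smul, hcj, neg_smul, Finset.sum_neg_distrib, neg_neg, hc,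
    sub_add_cancel]

theorem inner_normalizationOfSupport (hξ : IsEuclNormalization U x ξ) (hu : u ∈ U)
    (q : Param n → ℝ) : ⟪ξ u, normalizationOfSupport x ξ q u⟫ = q u := by
  rw [normalizationOfSupport, inner_add_right, inner_neg_right, real_inner_smul_right,
    real_inner_self_eq_norm_sq, hξ.norm_eq_one u hu]
  simp [inner_sum, real_inner_smul_right, hξ.normal u hu]

theorem phi_eq_exp {r s : WithTop ℕ∞} (hx : IsHypersurface r U x)
    (hξ : IsEuclNormalization U x ξ) (hK : gaussCurv x ξ u ≠ 0)
    (hy : IsRelNormalization s U x y) (hu : u ∈ U) :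
    phi x ξ y u = Real.exp (logRatio x ξ y u / (2 * n)) := by
  rw [phi, logRatio_eq hK, Real.rpow_def_of_pos (abs_pos.2 hK),
    Real.rpow_def_of_pos (abs_pos.2 (support_ne_zero hx hξ hy hu)), ← Real.exp_add]
  congr 1
  ring

theorem log_abs_support_div (hK : gaussCurv x ξ u ≠ 0) (hq : support ξ y u ≠ 0) :
    Real.log |support ξ y u / |gaussCurv x ξ u| ^ (1 / ((n : ℝ) + 2))| =
      logRatio x ξ y u / ((n : ℝ) + 2) := by
  have hK' := abs_pos.2 hK
  rw [logRatio_eq hK, Real.log_abs, Real.log_div hq (Real.rpow_pos_of_pos hK' _).ne',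
    Real.log_rpow hK', Real.log_abs (support ξ y u)]
  have : (n : ℝ) + 2 ≠ 0 := by positivity
  field_simp

end Geometry

/-! ### The equivalent properties as constancy of `logRatio` -/

section Characterization

variable {n : ℕ} {U : Set (Param n)} {x ξ y : Param n → Amb n}

theorem phi_const_iff (hn : 1 ≤ n) (hx : IsHypersurface 3 U x) (hξ : IsEuclNormalization U x ξ)
    (hK : ∀ u ∈ U, gaussCurv x ξ u ≠ 0) (hy : IsRelNormalization 1 U x y) :
    (∃ c : ℝ, ∀ u ∈ U, phi x ξ y u = c) ↔ ∃ c : ℝ, ∀ u ∈ U, logRatio x ξ y u = c := by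
  have hn0 : (2 * n : ℝ) ≠ 0 := by positivity
  constructor
  · rintro ⟨c, hc⟩
    refine ⟨2 * n * Real.log c, fun u hu => ?_⟩
    rw [← hc u hu, phi_eq_exp hx hξ (hK u hu) hy hu, Real.log_exp, mul_div_cancel₀ _ hn0]
  · rintro ⟨c, hc⟩
    exact ⟨Real.exp (c / (2 * n)), fun u hu => by
      rw [phi_eq_exp hx hξ (hK u hu) hy hu, hc u hu]⟩

theorem logRatio_const_iff_fderiv (hU : IsPreconnected U) (hx : IsHypersurface 3 U x)
    (hξ : IsEuclNormalization U x ξ) (hK : ∀ u ∈ U, gaussCurv x ξ u ≠ 0)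
    (hy : IsRelNormalization 1 U x y) :
    (∃ c : ℝ, ∀ u ∈ U, logRatio x ξ y u = c) ↔ ∀ u ∈ U, fderiv ℝ (logRatio x ξ y) u = 0 := by
  constructor
  · rintro ⟨c, hc⟩ u hu
    exact fderiv_eq_zero_of_pd fun i => by rw [pd_congr_on hx.isOpen hc hu, pd_const]
  · intro h
    exact hx.isOpen.exists_is_const_of_fderiv_eq_zero hU (fun u hu =>
      (hasFDerivAt_logRatio hx hξ (hK u hu) hy hu).differentiableAt.differentiableWithinAt) h

theorem logRatio_const_iff_support (hU : IsPreconnected U) (hx : IsHypersurface 3 U x)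
    (hξ : IsEuclNormalization U x ξ) (hK : ∀ u ∈ U, gaussCurv x ξ u ≠ 0)
    (hy : IsRelNormalization 1 U x y) :
    (∃ c : ℝ, ∀ u ∈ U, logRatio x ξ y u = c) ↔ ∃ l : ℝ, l ≠ 0 ∧ ∀ u ∈ U,
      support ξ y u = l * |gaussCurv x ξ u| ^ (1 / ((n : ℝ) + 2)) := by
  have hn2 : (n : ℝ) + 2 ≠ 0 := by positivity
  have hq0 : ∀ u ∈ U, support ξ y u ≠ 0 := fun u hu => support_ne_zero hx hξ hy hu
  have hpos : ∀ u ∈ U, 0 < |gaussCurv x ξ u| ^ (1 / ((n : ℝ) + 2)) := fun u hu =>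
    Real.rpow_pos_of_pos (abs_pos.2 (hK u hu)) _
  constructor
  · rintro ⟨c, hc⟩
    have habs : ∀ u ∈ U, |support ξ y u| =
        Real.exp (c / ((n : ℝ) + 2)) * |gaussCurv x ξ u| ^ (1 / ((n : ℝ) + 2)) := fun u hu => by
      have h := log_abs_support_div (y := y) (hK u hu) (hq0 u hu)
      rw [hc u hu] at h
      rw [← h, Real.exp_log (abs_pos.2 (div_ne_zero (hq0 u hu) (hpos u hu).ne')), abs_div,
        abs_of_pos (hpos u hu), div_mul_cancel₀ _ (hpos u hu).ne']
    have hcont : ContinuousOn (support ξ y) U := fun u hu =>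
      (differentiableAt_support hx.isOpen hξ hy hu).continuousAt.continuousWithinAt
    -- A change of sign would force a zero of q by the intermediate value theorem.
    have hsign : (∀ u ∈ U, 0 < support ξ y u) ∨ ∀ u ∈ U, support ξ y u < 0 := by
      by_contra hcon
      push Not at hcon
      obtain ⟨⟨a, ha, ha'⟩, b, hb, hb'⟩ := hcon
      obtain ⟨w, hw, hw0⟩ := hU.intermediate_value ha hb hcont ⟨ha', hb'⟩
      exact hq0 w hw hw0
    rcases hsign with h | h
    · exact ⟨Real.exp (c / ((n : ℝ) + 2)), (Real.exp_pos _).ne', fun u hu => by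
        rw [← habs u hu, abs_of_pos (h u hu)]⟩
    · exact ⟨-Real.exp (c / ((n : ℝ) + 2)), neg_ne_zero.2 (Real.exp_pos _).ne', fun u hu => by
        rw [neg_mul, ← habs u hu, abs_of_neg (h u hu), neg_neg]⟩
  · rintro ⟨l, -, h⟩
    -- The ratio of q to |K|^{1/(n+2)} is l, and its logarithm is L/(n+2).
    refine ⟨((n : ℝ) + 2) * Real.log |l|, fun u hu => ?_⟩
    have h' := log_abs_support_div (y := y) (hK u hu) (hq0 u hu)
    rw [h u hu, mul_div_cancel_right₀ _ (hpos u hu).ne'] at h'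
    rw [h', mul_div_cancel₀ _ hn2]

/-- Forward, the reconstruction of y from q is linear in q, so the constant l factors out. Backward,
pair with ξ. -/
theorem support_eq_iff_eq_equiaffine (hx : IsHypersurface 3 U x) (hξ : IsEuclNormalization U x ξ)
    (hK : ∀ u ∈ U, gaussCurv x ξ u ≠ 0) (hy : IsRelNormalization 1 U x y) (l : ℝ) :
    (∀ u ∈ U, support ξ y u = l * |gaussCurv x ξ u| ^ (1 / ((n : ℝ) + 2))) ↔
      ∀ u ∈ U, y u = l • equiaffine x ξ u := by
  constructor
  · intro h u hu
    have hq : ∀ w ∈ U, support ξ y w = l * supportAff x ξ w := h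
    rw [eq_normalizationOfSupport hx hξ (hK u hu) hy hu, equiaffine, normalizationOfSupport,
      normalizationOfSupport, smul_add, smul_neg, hq u hu, smul_smul, Finset.smul_sum]
    simp_rw [Finset.smul_sum, smul_smul, pd_congr_on hx.isOpen hq hu, pd_const_mul,
      mul_left_comm]
  · intro h u hu
    rw [support, h u hu, real_inner_smul_right, equiaffine, inner_normalizationOfSupport hξ hu,
      supportAff]

end Characterization

end RelGeom

theorem mainTheorem4 (n : ℕ) (hn : 1 ≤ n) (r s : WithTop ℕ∞) (hs : 1 ≤ s) (hsr : s < r)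
    (hr : 3 ≤ r) (U : Set (RelGeom.Param n)) (hU : IsPreconnected U)
    (x ξ y : RelGeom.Param n → RelGeom.Amb n)
    (hx : RelGeom.IsHypersurface r U x)
    (hξ : RelGeom.IsEuclNormalization U x ξ)
    (hK : ∀ u ∈ U, RelGeom.gaussCurv x ξ u ≠ 0)
    (hy : RelGeom.IsRelNormalization s U x y) :
    List.TFAE [
      ∃ c : ℝ, ∀ u ∈ U, RelGeom.phi x ξ y u = c,
      ∀ u ∈ U, ∀ v : RelGeom.Param n,
        inner ℝ (RelGeom.tchebychev x y u) (fderiv ℝ ξ u v) = 0,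
      ∃ l : ℝ, l ≠ 0 ∧ ∀ u ∈ U,
        RelGeom.support ξ y u = l * |RelGeom.gaussCurv x ξ u| ^ (1 / ((n : ℝ) + 2))] ∧
    ∀ l : ℝ, l ≠ 0 →
      ((∀ u ∈ U, RelGeom.support ξ y u =
          l * |RelGeom.gaussCurv x ξ u| ^ (1 / ((n : ℝ) + 2))) ↔
        ∀ u ∈ U, y u = l • RelGeom.equiaffine x ξ u) := by
  -- Three derivatives of x and one of y suffice for the whole argument.
  have hx3 := hx.of_le hr
  have hy1 := hy.of_le hs
  have hac := RelGeom.phi_const_iff hn hx3 hξ hK hy1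
  refine ⟨?_, fun l _ => RelGeom.support_eq_iff_eq_equiaffine hx3 hξ hK hy1 l⟩
  tfae_have 1 ↔ 2 := by
    rw [hac, RelGeom.logRatio_const_iff_fderiv hU hx3 hξ hK hy1]
    exact forall₂_congr fun u hu =>
      (RelGeom.inner_tchebychev_fderiv_eq_zero_iff hn hx3 hξ hK hy1 hu).symm
  tfae_have 1 ↔ 3 := hac.trans (RelGeom.logRatio_const_iff_support hU hx3 hξ hK hy1)
  tfae_finish
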